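/- Let $\mathbb{k}$ be a field of characteristic $0$. A \emph{directed simple graph} on the vertices $1,\dots,n$ ($n\ge 1$) is a connected directed graph without directed cycles and with at most one edge between any two vertices. Let $\mathrm{Lie}\textrm{-}\mathrm{gra}$ be the symmetric operad in $\mathbb{k}$-vector spaces such that $\mathrm{Lie}\textrm{-}\mathrm{gra}(n)$ has for basis the set of directed simple graphs on the vertices $1,\dots,n$ (in particular $\mathrm{Lie}\textrm{-}\mathrm{gra}(0)=0$), with the symmetric group $\mathbb{S}_n$ acting by relabelling the vertices, with unit the graph with one vertex, and with partial composition $\mathrm{g}_1\circ_i \mathrm{g}_2$ equal to the sum of all the graphs obtained by inserting $\mathrm{g}_2$ at the vertex $i$ of $\mathrm{g}_1$ and replacing, for each vertex $j$ joined to $i$ in $\mathrm{g}_1$, the edge between $j$ and $i$ by edges with the same direction between $j$ and at least one vertex of $\mathrm{g}_2$; the labels $1,\dots,i-1$ of $\mathrm{g}_1$ are kept, the labels of $\mathrm{g}_2$ are shifted by $i-1$, and the labels greater than $i$ of $\mathrm{g}_1$ are shifted by $|\mathrm{g}_2|-1$, where $|\mathrm{g}_2|$ is the number of vertices of $\mathrm{g}_2$.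 An operad $\mathcal{P}$ is \emph{finitely generated} if there is an $\mathbb{S}$-module $E$ with $\bigoplus_{n} E(n)$ finite dimensional, together with a morphism of operads $\mathcal{T}(E)\to\mathcal{P}$ from the free operad on $E$ that is surjective in every arity; equivalently, $\mathcal{P}\cong\mathcal{T}(E)/(R)$ for such an $E$ and some relations $R$. Then the operad $\mathrm{Lie}\textrm{-}\mathrm{gra}$ is not finitely generated. -/

import Mathlib

/-! ### Labels of a partial composite

Labels `1, …, n` are represented by `Fin n` (so all labels are shifted by one).  Inserting something
with `n` labels at the label `i` of something with `m` labels gives `r = m + n - 1` labels; this is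
recorded as `r + 1 = m + n`. -/

/-- The position in the composite of the label `u` of the inserted object: the shift by `i`. -/
def blockIncl {m n r : ℕ} (h : r + 1 = m + n) (i : Fin m) (u : Fin n) : Fin r :=
  ⟨i.1 + u.1, by omega⟩

/-- The label from which a position of the composite comes: positions `< i` keep their label, the
block `i, …, i + n - 1` is sent to `i`, and the remaining labels are shifted by `n - 1`. -/
def blockProj {m n r : ℕ} (h : r + 1 = m + n) (i : Fin m) (x : Fin r) : Fin m :=
  ⟨if x.1 < i.1 then x.1 else if x.1 < i.1 + n then i.1 else x.1 + 1 - n, by split_ifs <;> omega⟩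

/-- `ρ` is the block permutation `σ ∘_i τ`: it moves the block of `i` onto the block of `σ i`, acting
inside it as `τ`, and acts as `σ` on the blocks. -/
structure IsBlockPerm {m n r : ℕ} (h : r + 1 = m + n) (i : Fin m) (σ : Equiv.Perm (Fin m))
    (τ : Equiv.Perm (Fin n)) (ρ : Equiv.Perm (Fin r)) : Prop where
  incl : ∀ u, ρ (blockIncl h i u) = blockIncl h (σ i) (τ u)
  proj : ∀ x, blockProj h (σ i) (ρ x) = σ (blockProj h i x)

/-! ### Symmetric operads -/

universe u

/-- An `𝕊`-module over `k`: a sequence of representations of the symmetric groups (with left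
actions). -/
structure SymmModule (k : Type u) [Field k] where
  obj : ℕ → Type u
  [grp : ∀ n, AddCommGroup (obj n)]
  [mod : ∀ n, Module k (obj n)]
  act : ∀ n, Representation k (Equiv.Perm (Fin n)) (obj n)

attribute [instance] SymmModule.grp SymmModule.mod

/-- A morphism of `𝕊`-modules. -/
structure SymmModule.Hom {k : Type u} [Field k] (E F : SymmModule k) where
  map : ∀ n, E.obj n →ₗ[k] F.obj n
  map_act : ∀ n (σ : Equiv.Perm (Fin n)) (x : E.obj n),
    map n (E.act n σ x) = F.act n σ (map n x)

/-- A symmetric operad in `k`-vector spaces, in the partial composition presentation. -/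
structure SymmOperad (k : Type u) [Field k] extends SymmModule k where
  one : obj 1
  /-- The partial composition `x ∘_i y`. -/
  circ : ∀ {m n r : ℕ} (_ : r + 1 = m + n) (_ : Fin m), obj m →ₗ[k] obj n →ₗ[k] obj r
  one_circ : ∀ {n : ℕ} (h : n + 1 = 1 + n) (x : obj n), circ h 0 one x = x
  circ_one : ∀ {n : ℕ} (h : n + 1 = n + 1) (i : Fin n) (x : obj n), circ h i x one = x
  /-- The sequential axiom `(x ∘_i y) ∘_{i-1+j} z = x ∘_i (y ∘_j z)`. -/
  seq_assoc : ∀ {l m n r s t : ℕ} (hr : r + 1 = l + m) (ht : t + 1 = r + n)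
    (hs : s + 1 = m + n) (ht' : t + 1 = l + s) (i : Fin l) (j : Fin m)
    (x : obj l) (y : obj m) (z : obj n),
    circ ht (blockIncl hr i j) (circ hr i x y) z = circ ht' i x (circ hs j y z)
  /-- The parallel axiom `(x ∘_i y) ∘_{k-1+m} z = (x ∘_k z) ∘_i y` for `i < k`. -/
  par_assoc : ∀ {l m n r s t : ℕ} (hr : r + 1 = l + m) (ht : t + 1 = r + n)
    (hs : s + 1 = l + n) (ht' : t + 1 = s + m) (i k : Fin l) (_ : i < k)
    (k' : Fin r) (_ : k'.1 + 1 = k.1 + m) (i' : Fin s) (_ : i'.1 = i.1)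
    (x : obj l) (y : obj m) (z : obj n),
    circ ht k' (circ hr i x y) z = circ ht' i' (circ hs k x z) y
  /-- Equivariance of the partial compositions. -/
  circ_act : ∀ {m n r : ℕ} (h : r + 1 = m + n) (i : Fin m) (σ : Equiv.Perm (Fin m))
    (τ : Equiv.Perm (Fin n)) (ρ : Equiv.Perm (Fin r)) (_ : IsBlockPerm h i σ τ ρ)
    (x : obj m) (y : obj n),
    circ h (σ i) (act m σ x) (act n τ y) = act r ρ (circ h i x y)

/-- A morphism of operads. -/
structure SymmOperad.Hom {k : Type u} [Field k] (P Q : SymmOperad k) extends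
    SymmModule.Hom P.toSymmModule Q.toSymmModule where
  map_one : map 1 P.one = Q.one
  map_circ : ∀ {m n r : ℕ} (h : r + 1 = m + n) (i : Fin m) (x : P.obj m) (y : P.obj n),
    map r (P.circ h i x y) = Q.circ h i (map m x) (map n y)

/-! ### The free operad -/

/-- Formal operadic expressions in elements of the `𝕊`-module `E`. -/
inductive FreeOperad.Term {k : Type u} [Field k] (E : SymmModule k) : ℕ → Type u
  | of (n : ℕ) (e : E.obj n) : FreeOperad.Term E n
  | zero (n : ℕ) : FreeOperad.Term E n
  | add {n : ℕ} (x y : FreeOperad.Term E n) : FreeOperad.Term E n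
  | smul {n : ℕ} (c : k) (x : FreeOperad.Term E n) : FreeOperad.Term E n
  | act {n : ℕ} (σ : Equiv.Perm (Fin n)) (x : FreeOperad.Term E n) : FreeOperad.Term E n
  | one : FreeOperad.Term E 1
  | circ {m n r : ℕ} (h : r + 1 = m + n) (i : Fin m) (x : FreeOperad.Term E m)
      (y : FreeOperad.Term E n) : FreeOperad.Term E r

/-- The value of a formal expression in an operad `P`, given a morphism of `𝕊`-modules `E → P`. -/
def FreeOperad.eval {k : Type u} [Field k] {E : SymmModule k} {P : SymmOperad k}
    (φ : SymmModule.Hom E P.toSymmModule) : ∀ {n : ℕ}, FreeOperad.Term E n → P.obj n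
  | _, .of n e => φ.map n e
  | _, .zero _ => 0
  | _, .add x y => FreeOperad.eval φ x + FreeOperad.eval φ y
  | _, .smul c x => c • FreeOperad.eval φ x
  | _, .act σ x => P.act _ σ (FreeOperad.eval φ x)
  | _, .one => P.one
  | _, .circ h i x y => P.circ h i (FreeOperad.eval φ x) (FreeOperad.eval φ y)

/-- Two expressions define the same element of the free operad when the operad laws force them to
agree, that is when they take the same value in every operad under every morphism of `𝕊`-modules. -/
def FreeOperad.setoid {k : Type u} [Field k] (E : SymmModule k) (n : ℕ) :
    Setoid (FreeOperad.Term E n) where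
  r x y := ∀ (P : SymmOperad.{u} k) (φ : SymmModule.Hom E P.toSymmModule),
    FreeOperad.eval φ x = FreeOperad.eval φ y
  iseqv := ⟨fun _ _ _ => rfl, fun h P φ => (h P φ).symm, fun h h' P φ => (h P φ).trans (h' P φ)⟩

/-- The space of operations of arity `n` of the free operad on `E`. -/
def FreeOperad.Obj {k : Type u} [Field k] (E : SymmModule k) (n : ℕ) : Type u :=
  Quotient (FreeOperad.setoid E n)

instance FreeOperad.instZero {k : Type u} [Field k] (E : SymmModule k) (n : ℕ) :
    Zero (FreeOperad.Obj E n) where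
  zero := Quotient.mk _ (.zero n)

instance FreeOperad.instAdd {k : Type u} [Field k] (E : SymmModule k) (n : ℕ) :
    Add (FreeOperad.Obj E n) where
  add := Quotient.map₂ .add fun _ _ h _ _ h' P φ => by simp only [FreeOperad.eval, h P φ, h' P φ]

instance FreeOperad.instNeg {k : Type u} [Field k] (E : SymmModule k) (n : ℕ) :
    Neg (FreeOperad.Obj E n) where
  neg := Quotient.map (.smul (-1)) fun _ _ h P φ => by simp only [FreeOperad.eval, h P φ]

instance FreeOperad.instAddCommGroup {k : Type u} [Field k] (E : SymmModule k) (n : ℕ) :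
    AddCommGroup (FreeOperad.Obj E n) where
  nsmul := nsmulRec
  zsmul := zsmulRec
  add_assoc := by
    rintro ⟨x⟩ ⟨y⟩ ⟨z⟩
    exact Quotient.sound fun P φ => by simp only [FreeOperad.eval, add_assoc]
  zero_add := by
    rintro ⟨x⟩
    exact Quotient.sound fun P φ => by simp only [FreeOperad.eval, zero_add]
  add_zero := by
    rintro ⟨x⟩
    exact Quotient.sound fun P φ => by simp only [FreeOperad.eval, add_zero]
  add_comm := by
    rintro ⟨x⟩ ⟨y⟩
    exact Quotient.sound fun P φ => by simp only [FreeOperad.eval, add_comm]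
  neg_add_cancel := by
    rintro ⟨x⟩
    exact Quotient.sound fun P φ => by simp [FreeOperad.eval]

instance FreeOperad.instModule {k : Type u} [Field k] (E : SymmModule k) (n : ℕ) :
    Module k (FreeOperad.Obj E n) where
  smul c := Quotient.map (.smul c) fun _ _ h P φ => by simp only [FreeOperad.eval, h P φ]
  one_smul := by
    rintro ⟨x⟩
    exact Quotient.sound fun P φ => by simp only [FreeOperad.eval, one_smul]
  mul_smul := by
    rintro a b ⟨x⟩
    exact Quotient.sound fun P φ => by simp only [FreeOperad.eval, mul_smul]
  smul_zero := by
    rintro a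
    exact Quotient.sound fun P φ => by simp only [FreeOperad.eval, smul_zero]
  smul_add := by
    rintro a ⟨x⟩ ⟨y⟩
    exact Quotient.sound fun P φ => by simp only [FreeOperad.eval, smul_add]
  add_smul := by
    rintro a b ⟨x⟩
    exact Quotient.sound fun P φ => by simp only [FreeOperad.eval, add_smul]
  zero_smul := by
    rintro ⟨x⟩
    exact Quotient.sound fun P φ => by simp only [FreeOperad.eval, zero_smul]

/-- The free operad `𝒯(E)` on the `𝕊`-module `E`. -/
def freeOperad {k : Type u} [Field k] (E : SymmModule k) : SymmOperad k where
  obj := FreeOperad.Obj E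
  act n :=
    { toFun := fun σ =>
        { toFun := Quotient.map (.act σ) fun _ _ h P φ => by simp only [FreeOperad.eval, h P φ]
          map_add' := by
            rintro ⟨x⟩ ⟨y⟩
            exact Quotient.sound fun P φ => by simp only [FreeOperad.eval, map_add]
          map_smul' := by
            rintro c ⟨x⟩
            exact Quotient.sound fun P φ => by
              simp only [FreeOperad.eval, map_smul, RingHom.id_apply] }
      map_one' := by
        ext ⟨x⟩
        exact Quotient.sound fun P φ => by
          simp only [FreeOperad.eval, map_one, Module.End.one_apply]
      map_mul' := by
        intro σ τ
        ext ⟨x⟩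
        exact Quotient.sound fun P φ => by
          simp only [FreeOperad.eval, map_mul, Module.End.mul_apply] }
  one := Quotient.mk _ .one
  circ h i := LinearMap.mk₂ k
    (Quotient.map₂ (.circ h i) fun _ _ h _ _ h' P φ => by
      simp only [FreeOperad.eval, h P φ, h' P φ])
    (by
      rintro ⟨x⟩ ⟨y⟩ ⟨z⟩
      exact Quotient.sound fun P φ => by
        simp only [FreeOperad.eval, map_add, LinearMap.add_apply])
    (by
      rintro c ⟨x⟩ ⟨y⟩
      exact Quotient.sound fun P φ => by
        simp only [FreeOperad.eval, map_smul, LinearMap.smul_apply])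
    (by
      rintro ⟨x⟩ ⟨y⟩ ⟨z⟩
      exact Quotient.sound fun P φ => by simp only [FreeOperad.eval, map_add])
    (by
      rintro c ⟨x⟩ ⟨y⟩
      exact Quotient.sound fun P φ => by simp only [FreeOperad.eval, map_smul])
  one_circ h := by
    rintro ⟨x⟩
    exact Quotient.sound fun P φ => P.one_circ h _
  circ_one h i := by
    rintro ⟨x⟩
    exact Quotient.sound fun P φ => P.circ_one h i _
  seq_assoc hr ht hs ht' i j := by
    rintro ⟨x⟩ ⟨y⟩ ⟨z⟩
    exact Quotient.sound fun P φ => P.seq_assoc hr ht hs ht' i j _ _ _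
  par_assoc hr ht hs ht' i k hik k' hk' i' hi' := by
    rintro ⟨x⟩ ⟨y⟩ ⟨z⟩
    exact Quotient.sound fun P φ => P.par_assoc hr ht hs ht' i k hik k' hk' i' hi' _ _ _
  circ_act h i σ τ ρ hρ := by
    rintro ⟨x⟩ ⟨y⟩
    exact Quotient.sound fun P φ => P.circ_act h i σ τ ρ hρ _ _

/-- The canonical morphism of `𝕊`-modules `E → 𝒯(E)`. -/
def FreeOperad.incl {k : Type u} [Field k] (E : SymmModule k) :
    SymmModule.Hom E (freeOperad E).toSymmModule where
  map n :=
    { toFun := fun e => Quotient.mk _ (.of n e)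
      map_add' := fun x y => Quotient.sound fun P φ => by simp only [FreeOperad.eval, map_add]
      map_smul' := fun c x => Quotient.sound fun P φ => by
        simp only [FreeOperad.eval, map_smul, RingHom.id_apply] }
  map_act n σ x := Quotient.sound fun P φ => by simp only [FreeOperad.eval, φ.map_act]

/-- The morphism of operads `𝒯(E) → P` extending a morphism of `𝕊`-modules `E → P`. -/
def FreeOperad.lift {k : Type u} [Field k] {E : SymmModule k} {P : SymmOperad k}
    (φ : SymmModule.Hom E P.toSymmModule) : SymmOperad.Hom (freeOperad E) P where
  map n :=
    { toFun := Quotient.lift (fun x => FreeOperad.eval φ x) fun _ _ h => h P φ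
      map_add' := by
        rintro ⟨x⟩ ⟨y⟩
        rfl
      map_smul' := by
        rintro c ⟨x⟩
        rfl }
  map_act n σ := by
    rintro ⟨x⟩
    rfl
  map_one := rfl
  map_circ h i := by
    rintro ⟨x⟩ ⟨y⟩
    rfl

/-- The universal property of the free operad. -/
theorem FreeOperad.existsUnique_lift {k : Type u} [Field k] {E : SymmModule k} {P : SymmOperad k}
    (φ : SymmModule.Hom E P.toSymmModule) :
    ∃! f : SymmOperad.Hom (freeOperad E) P,
      ∀ n (e : E.obj n), f.map n ((FreeOperad.incl E).map n e) = φ.map n e := by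
  refine ⟨FreeOperad.lift φ, fun n e => rfl, fun f hf => ?_⟩
  have key : ∀ n (x : FreeOperad.Term E n),
      f.map n (Quotient.mk _ x : FreeOperad.Obj E n) = FreeOperad.eval φ x := by
    intro n x
    induction x with
    | of n e => exact hf n e
    | zero n => exact map_zero (f.map n)
    | add x y hx hy => exact (map_add (f.map _) _ _).trans (congrArg₂ _ hx hy)
    | smul c x hx => exact (map_smul (f.map _) c _).trans (congrArg _ hx)
    | act σ x hx => exact (f.map_act _ σ _).trans (congrArg _ hx)
    | one => exact f.map_one
    | circ h i x y hx hy =>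
      refine (f.map_circ h i (Quotient.mk _ x : FreeOperad.Obj E _)
        (Quotient.mk _ y : FreeOperad.Obj E _)).trans ?_
      rw [hx, hy]
      rfl
  obtain ⟨⟨f, _⟩, _, _⟩ := f
  have : f = (FreeOperad.lift φ).map := by
    funext n
    ext ⟨x⟩
    exact key n x
  subst this
  rfl

/-- An operad `P` is finitely generated if it is a quotient of the free operad on an `𝕊`-module `E`
of finite total dimension, that is if there is a morphism of operads `𝒯(E) → P` which is surjective in
every arity (equivalently, `P ≅ 𝒯(E)/(R)` for the kernel `R` of this morphism). -/
def SymmOperad.FinitelyGenerated {k : Type u} [Field k] (P : SymmOperad k) : Prop :=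
  ∃ E : SymmModule k, FiniteDimensional k (DirectSum ℕ E.obj) ∧
    ∃ f : SymmOperad.Hom (freeOperad E) P, ∀ n, Function.Surjective (f.map n)

/-! ### Directed simple graphs -/

/-- A directed simple graph with vertices labelled by `Fin n`: a connected graph with at least one
vertex, directed by a global flow (there is no directed cycle) and with at most one edge between two
vertices; `adj a b` means that there is an edge from `a` to `b`.  That `a` and `b` are not joined by
edges in both directions, and that there are no loops, is part of the absence of directed cycles; that
`n ≥ 1` is part of `SimpleGraph.Connected`. -/
@[ext]
structure DSGraph (n : ℕ) where
  adj : Fin n → Fin n → Prop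
  acyclic : ∀ a, ¬ Relation.TransGen adj a a
  connected : (SimpleGraph.fromRel adj).Connected

theorem DSGraph.irrefl {n : ℕ} (g : DSGraph n) (a : Fin n) : ¬ g.adj a a :=
  fun h => g.acyclic a (.single h)

instance DSGraph.instFinite (n : ℕ) : Finite (DSGraph n) :=
  Finite.of_injective DSGraph.adj fun _ _ h => DSGraph.ext h

noncomputable instance DSGraph.instFintype (n : ℕ) : Fintype (DSGraph n) := Fintype.ofFinite _

/-- `g` is obtained by inserting `g₂` in `g₁`, where `π` sends a vertex of the result to the vertex of
`g₁` it comes from and `ι` is the inclusion of the vertices of the inserted graph: the block of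
inserted vertices carries the graph `g₂`, and an edge from `a` to `b` of `g₁` is replaced by at least
one edge from a vertex over `a` to a vertex over `b` (there is only one vertex over `a`, unless `a` is
the vertex where `g₂` is inserted), and there are no other edges. -/
structure IsInsertion {A B C : Type} (π : C → A) (ι : B → C) (g₁ : A → A → Prop)
    (g₂ : B → B → Prop) (g : C → C → Prop) : Prop where
  restrict : ∀ u v, g (ι u) (ι v) ↔ g₂ u v
  contract : ∀ a b, a ≠ b → (g₁ a b ↔ ∃ x y, π x = a ∧ π y = b ∧ g x y)

/-- The combinatorics of the labels of a composite: the fibre of `π` at `i` is the block, and the other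
fibres have exactly one element. -/
structure IsBlock {A B C : Type} (π : C → A) (ι : B → C) (i : A) : Prop where
  proj_incl : ∀ u, π (ι u) = i
  exists_incl : ∀ x, π x = i → ∃ u, ι u = x
  incl_inj : Function.Injective ι
  proj_inj : ∀ x y, π x = π y → π x ≠ i → x = y
  proj_surj : ∀ a, a ≠ i → ∃ x, π x = a

theorem blockProj_spec {m n r : ℕ} (h : r + 1 = m + n) (i : Fin m) (x : Fin r) :
    (x.1 < i.1 ∧ (blockProj h i x).1 = x.1) ∨
    (i.1 ≤ x.1 ∧ x.1 < i.1 + n ∧ (blockProj h i x).1 = i.1) ∨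
    (i.1 + n ≤ x.1 ∧ (blockProj h i x).1 + n = x.1 + 1) := by
  simp only [blockProj]
  split_ifs <;> omega

theorem blockIncl_val {m n r : ℕ} (h : r + 1 = m + n) (i : Fin m) (u : Fin n) :
    (blockIncl h i u).1 = i.1 + u.1 := rfl

theorem isBlock {m n r : ℕ} (h : r + 1 = m + n) (i : Fin m) :
    IsBlock (blockProj h i) (blockIncl h i) i where
  proj_incl u := by
    have h1 := blockProj_spec h i (blockIncl h i u)
    have h2 := blockIncl_val h i u
    ext
    omega
  exists_incl x hx := by
    have h1 := blockProj_spec h i x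
    rw [hx] at h1
    exact ⟨⟨x.1 - i.1, by omega⟩, by ext; simp only [blockIncl]; omega⟩
  incl_inj u v huv := by
    have h1 := congrArg Fin.val huv
    simp only [blockIncl] at h1
    ext
    omega
  proj_inj x y hxy hx := by
    have h1 := blockProj_spec h i x
    have h2 := blockProj_spec h i y
    have h3 : (blockProj h i x).1 ≠ i.1 := fun h => hx (Fin.ext h)
    rw [← hxy] at h2
    ext
    omega
  proj_surj a ha := by
    have h1 : a.1 ≠ i.1 := fun h => ha (Fin.ext h)
    rcases lt_or_gt_of_ne h1 with h2 | h2
    · refine ⟨⟨a.1, by omega⟩, ?_⟩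
      have h3 := blockProj_spec h i ⟨a.1, by omega⟩
      ext
      simp only at h3
      omega
    · refine ⟨⟨a.1 + n - 1, by omega⟩, ?_⟩
      have h3 := blockProj_spec h i ⟨a.1 + n - 1, by omega⟩
      ext
      simp only at h3
      omega

/-- The block permutation `σ ∘_i τ` exists and is unique. -/
theorem existsUnique_isBlockPerm {m n r : ℕ} (h : r + 1 = m + n) (i : Fin m)
    (σ : Equiv.Perm (Fin m)) (τ : Equiv.Perm (Fin n)) : ∃! ρ, IsBlockPerm h i σ τ ρ := by
  have hb := isBlock h i
  have hb' := isBlock h (σ i)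
  have hex : ∀ x, ∃ y, blockProj h (σ i) y = σ (blockProj h i x) ∧
      ∀ u, x = blockIncl h i u → y = blockIncl h (σ i) (τ u) := by
    intro x
    by_cases hx : blockProj h i x = i
    · obtain ⟨u, rfl⟩ := hb.exists_incl x hx
      refine ⟨blockIncl h (σ i) (τ u), by rw [hb'.proj_incl, hx], fun v hv => ?_⟩
      rw [hb.incl_inj hv]
    · obtain ⟨y, hy⟩ := hb'.proj_surj _ fun h => hx (σ.injective h)
      exact ⟨y, hy, fun u hu => absurd (hu ▸ hb.proj_incl u) hx⟩
  choose f hf1 hf2 using hex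
  have hinj : Function.Injective f := by
    intro x y hxy
    have hπ : blockProj h i x = blockProj h i y := by
      rw [← σ.injective.eq_iff, ← hf1, ← hf1, hxy]
    by_cases hx : blockProj h i x = i
    · obtain ⟨u, rfl⟩ := hb.exists_incl x hx
      obtain ⟨v, rfl⟩ := hb.exists_incl y (hπ ▸ hx)
      rw [hf2 _ u rfl, hf2 _ v rfl] at hxy
      rw [τ.injective (hb'.incl_inj hxy)]
    · exact hb.proj_inj x y hπ hx
  refine ⟨Equiv.ofBijective f (Finite.injective_iff_bijective.1 hinj),
    ⟨fun u => hf2 _ u rfl, hf1⟩, fun ρ hρ => ?_⟩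
  ext1 x
  change ρ x = f x
  by_cases hx : blockProj h i x = i
  · obtain ⟨u, rfl⟩ := hb.exists_incl x hx
    rw [hρ.incl, hf2 _ u rfl]
  · refine hb'.proj_inj _ _ (by rw [hρ.proj, hf1]) ?_
    rw [hρ.proj]
    exact fun h => hx (σ.injective h)

/-- The graphs obtained by insertion have no directed cycle. -/
theorem IsInsertion.acyclic {A B C : Type} {π : C → A} {ι : B → C} {i : A} (hb : IsBlock π ι i)
    {g₁ : A → A → Prop} {g₂ : B → B → Prop} {g : C → C → Prop} (hg : IsInsertion π ι g₁ g₂ g)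
    (h₁ : ∀ a, ¬ Relation.TransGen g₁ a a) (h₂ : ∀ a, ¬ Relation.TransGen g₂ a a)
    (h0 : ∀ x, ¬ g x x) : ∀ x, ¬ Relation.TransGen g x x := by
  have step : ∀ x y, g x y → g₁ (π x) (π y) ∨ ∃ u v, x = ι u ∧ y = ι v ∧ g₂ u v := by
    intro x y hxy
    by_cases hπ : π x = π y
    · right
      by_cases hx : π x = i
      · obtain ⟨u, rfl⟩ := hb.exists_incl x hx
        obtain ⟨v, rfl⟩ := hb.exists_incl y (hπ ▸ hx)
        exact ⟨u, v, rfl, rfl, (hg.restrict u v).1 hxy⟩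
      · exact absurd (hb.proj_inj x y hπ hx ▸ hxy) (h0 _)
    · exact .inl ((hg.contract _ _ hπ).2 ⟨x, y, rfl, rfl, hxy⟩)
  have main : ∀ x y, Relation.TransGen g x y → Relation.TransGen g₁ (π x) (π y) ∨
      ∃ u v, x = ι u ∧ y = ι v ∧ Relation.TransGen g₂ u v := by
    intro x y hxy
    induction hxy with
    | single h =>
      rcases step _ _ h with h' | ⟨u, v, rfl, rfl, h'⟩
      · exact .inl (.single h')
      · exact .inr ⟨u, v, rfl, rfl, .single h'⟩
    | tail _ h ih =>
      rcases step _ _ h with h' | ⟨u, v, rfl, rfl, h'⟩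
      · rcases ih with ih | ⟨u', v', rfl, rfl, ih⟩
        · exact .inl (ih.tail h')
        · left
          rw [hb.proj_incl] at h' ⊢
          exact .single h'
      · rcases ih with ih | ⟨u', v', rfl, hv, ih⟩
        · left
          rwa [hb.proj_incl] at ih ⊢
        · exact .inr ⟨u', v, rfl, rfl, ih.tail (hb.incl_inj hv ▸ h')⟩
  intro x hx
  rcases main x x hx with h | ⟨u, v, rfl, hv, h⟩
  · exact h₁ _ h
  · exact h₂ _ (hb.incl_inj hv ▸ h)

/-- The graphs obtained by insertion are connected. -/
theorem IsInsertion.connected {A B C : Type} {π : C → A} {ι : B → C} {i : A} (hb : IsBlock π ι i)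
    {g₁ : A → A → Prop} {g₂ : B → B → Prop} {g : C → C → Prop} (hg : IsInsertion π ι g₁ g₂ g)
    (h₁ : (SimpleGraph.fromRel g₁).Connected) (h₂ : (SimpleGraph.fromRel g₂).Connected) :
    (SimpleGraph.fromRel g).Connected := by
  have hblock : ∀ u v, (SimpleGraph.fromRel g).Reachable (ι u) (ι v) := by
    intro u v
    refine SimpleGraph.Reachable.map (G := SimpleGraph.fromRel g₂)
      ⟨ι, fun {a b} hab => ?_⟩ (h₂.preconnected u v)
    rw [SimpleGraph.fromRel_adj] at hab ⊢
    simpa only [hg.restrict] using ⟨fun h => hab.1 (hb.incl_inj h), hab.2⟩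
  have hfib : ∀ x y, π x = π y → (SimpleGraph.fromRel g).Reachable x y := by
    intro x y hxy
    by_cases hx : π x = i
    · obtain ⟨u, rfl⟩ := hb.exists_incl x hx
      obtain ⟨v, rfl⟩ := hb.exists_incl y (hxy ▸ hx)
      exact hblock u v
    · rw [hb.proj_inj x y hxy hx]
  have hstep : ∀ a b, (SimpleGraph.fromRel g₁).Adj a b → ∃ x y, π x = a ∧ π y = b ∧
      (SimpleGraph.fromRel g).Reachable x y := by
    intro a b hab
    rw [SimpleGraph.fromRel_adj] at hab
    obtain ⟨hne, hab | hab⟩ := hab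
    · obtain ⟨x, y, rfl, rfl, hxy⟩ := (hg.contract _ _ hne).1 hab
      refine ⟨x, y, rfl, rfl, SimpleGraph.Adj.reachable ?_⟩
      rw [SimpleGraph.fromRel_adj]
      exact ⟨fun h => hne (congrArg π h), .inl hxy⟩
    · obtain ⟨x, y, rfl, rfl, hxy⟩ := (hg.contract _ _ hne.symm).1 hab
      refine ⟨y, x, rfl, rfl, SimpleGraph.Adj.reachable ?_⟩
      rw [SimpleGraph.fromRel_adj]
      exact ⟨fun h => hne (congrArg π h), .inr hxy⟩
  have hwalk : ∀ a b, (SimpleGraph.fromRel g₁).Walk a b → ∀ x y, π x = a → π y = b →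
      (SimpleGraph.fromRel g).Reachable x y := by
    intro a b w
    induction w with
    | nil => exact fun x y hx hy => hfib x y (hx.trans hy.symm)
    | cons hab _ ih =>
      intro x y hx hy
      obtain ⟨x', y', hx', hy', h⟩ := hstep _ _ hab
      exact (hfib x x' (hx.trans hx'.symm)).trans (h.trans (ih y' y hy' hy))
  obtain ⟨u⟩ := h₂.nonempty
  have : Nonempty C := ⟨ι u⟩
  refine ⟨fun x y => ?_⟩
  obtain ⟨w⟩ := h₁.preconnected (π x) (π y)
  exact hwalk _ _ w x y rfl rfl

/-- Sequential composites of insertions: inserting `g₂` in `g₁` and then `g₃` in the result, at a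
vertex of `g₂`, is the same as inserting in `g₁` the result of inserting `g₃` in `g₂`. -/
theorem IsInsertion.seq_iff {A B D AB BD T : Type} {i : A}
    {πr : AB → A} {ιr : B → AB} (hr : IsBlock πr ιr i)
    {πs : BD → B} {ιs : D → BD} {πt : T → AB} {ιt : D → T}
    {πt' : T → A} {ιt' : BD → T} (ht' : IsBlock πt' ιt' i)
    (c₁ : ∀ x, πr (πt x) = πt' x) (c₂ : ∀ y, πt (ιt' y) = ιr (πs y))
    (c₃ : ∀ d, ιt' (ιs d) = ιt d)
    {g₁ : A → A → Prop} {g₂ : B → B → Prop} {g₃ : D → D → Prop} {g : T → T → Prop}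
    (irr₂ : ∀ b, ¬ g₂ b b) :
    (∀ g' : AB → AB → Prop, IsInsertion πr ιr g₁ g₂ g' → IsInsertion πt ιt g' g₃ g →
      ∃ g'', IsInsertion πs ιs g₂ g₃ g'' ∧ IsInsertion πt' ιt' g₁ g'' g ∧
        ∀ y y', g'' y y' ↔ g (ιt' y) (ιt' y')) ∧
    (∀ g'' : BD → BD → Prop, IsInsertion πs ιs g₂ g₃ g'' → IsInsertion πt' ιt' g₁ g'' g →
      ∃ g', IsInsertion πr ιr g₁ g₂ g' ∧ IsInsertion πt ιt g' g₃ g ∧ ∀ a, ¬ g' a a) := by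
  constructor
  · intro g' h1 h2
    refine ⟨fun y y' => g (ιt' y) (ιt' y'), ⟨fun u v => ?_, fun a b hab => ?_⟩,
      ⟨fun _ _ => Iff.rfl, fun a b hab => ?_⟩, fun _ _ => Iff.rfl⟩
    · rw [c₃, c₃, h2.restrict]
    · rw [← h1.restrict, h2.contract _ _ fun h => hab (hr.incl_inj h)]
      constructor
      · rintro ⟨x, y, hx, hy, hxy⟩
        obtain ⟨x, rfl⟩ := ht'.exists_incl x (by rw [← c₁, hx, hr.proj_incl])
        obtain ⟨y, rfl⟩ := ht'.exists_incl y (by rw [← c₁, hy, hr.proj_incl])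
        rw [c₂] at hx hy
        exact ⟨x, y, hr.incl_inj hx, hr.incl_inj hy, hxy⟩
      · rintro ⟨x, y, rfl, rfl, hxy⟩
        exact ⟨_, _, c₂ x, c₂ y, hxy⟩
    · rw [h1.contract a b hab]
      constructor
      · rintro ⟨x, y, rfl, rfl, hxy⟩
        rw [h2.contract _ _ fun h => hab (congrArg πr h)] at hxy
        obtain ⟨x, y, rfl, rfl, hxy⟩ := hxy
        exact ⟨x, y, (c₁ x).symm, (c₁ y).symm, hxy⟩
      · rintro ⟨x, y, rfl, rfl, hxy⟩
        refine ⟨πt x, πt y, c₁ x, c₁ y, (h2.contract _ _ fun h => hab ?_).2 ⟨x, y, rfl, rfl, hxy⟩⟩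
        rw [← c₁, ← c₁, h]
  · intro g'' h1 h2
    refine ⟨fun a b => a ≠ b ∧ ∃ x y, πt x = a ∧ πt y = b ∧ g x y,
      ⟨fun u v => ?_, fun a b hab => ?_⟩, ⟨fun u v => ?_, fun a b hab => ?_⟩, fun a h => h.1 rfl⟩
    · by_cases huv : u = v
      · subst huv
        simp [irr₂]
      · rw [h1.contract u v huv]
        constructor
        · rintro ⟨-, x, y, hx, hy, hxy⟩
          obtain ⟨x, rfl⟩ := ht'.exists_incl x (by rw [← c₁, hx, hr.proj_incl])
          obtain ⟨y, rfl⟩ := ht'.exists_incl y (by rw [← c₁, hy, hr.proj_incl])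
          rw [c₂] at hx hy
          exact ⟨x, y, hr.incl_inj hx, hr.incl_inj hy, (h2.restrict _ _).1 hxy⟩
        · rintro ⟨x, y, rfl, rfl, hxy⟩
          exact ⟨fun h => huv (hr.incl_inj h), ιt' x, ιt' y, c₂ x, c₂ y, (h2.restrict _ _).2 hxy⟩
    · rw [h2.contract a b hab]
      constructor
      · rintro ⟨x, y, rfl, rfl, hxy⟩
        refine ⟨πt x, πt y, c₁ x, c₁ y, fun h => hab ?_, x, y, rfl, rfl, hxy⟩
        rw [← c₁, ← c₁, h]
      · rintro ⟨_, _, rfl, rfl, -, x, y, rfl, rfl, hxy⟩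
        exact ⟨x, y, (c₁ x).symm, (c₁ y).symm, hxy⟩
    · rw [← c₃, ← c₃, h2.restrict, h1.restrict]
    · exact ⟨fun h => h.2, fun h => ⟨hab, h⟩⟩

/-- Parallel composites of insertions: the order of the insertions at two different vertices does not
matter. -/
theorem IsInsertion.par {A B D AB AD T : Type} {i k : A} {i' : AD} {k' : AB} (hik : i ≠ k)
    {πr : AB → A} {ιr : B → AB} (hr : IsBlock πr ιr i)
    {πs : AD → A} {ιs : D → AD} (hs : IsBlock πs ιs k)
    {πt : T → AB} {ιt : D → T} (ht : IsBlock πt ιt k')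
    {πt' : T → AD} {ιt' : B → T} (ht' : IsBlock πt' ιt' i')
    (hk' : πr k' = k) (hi' : πs i' = i)
    (c₁ : ∀ x, πr (πt x) = πs (πt' x)) (c₂ : ∀ b, πt (ιt' b) = ιr b)
    (c₃ : ∀ d, πt' (ιt d) = ιs d)
    {g₁ : A → A → Prop} {g₂ : B → B → Prop} {g₃ : D → D → Prop} {g : T → T → Prop}
    (irr : ∀ x, ¬ g x x) (irr₂ : ∀ b, ¬ g₂ b b)
    (g' : AB → AB → Prop) (h1 : IsInsertion πr ιr g₁ g₂ g') (h2 : IsInsertion πt ιt g' g₃ g) :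
    ∃ g'', IsInsertion πs ιs g₁ g₃ g'' ∧ IsInsertion πt' ιt' g'' g₂ g ∧ ∀ a, ¬ g'' a a := by
  have e3 : ∀ x d, πt' x = ιs d → x = ιt d := by
    intro x d h
    refine ht'.proj_inj _ _ (h.trans (c₃ d).symm) fun h' => hik ?_
    rw [← hi', ← h', h, hs.proj_incl]
  have e2 : ∀ x b, πt x = ιr b → x = ιt' b := by
    intro x b h
    refine ht.proj_inj _ _ (h.trans (c₂ b).symm) fun h' => hik ?_
    rw [← hk', ← h', h, hr.proj_incl]
  refine ⟨fun a b => a ≠ b ∧ ∃ x y, πt' x = a ∧ πt' y = b ∧ g x y,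
    ⟨fun u v => ?_, fun a b hab => ?_⟩, ⟨fun u v => ?_, fun a b hab => ?_⟩, fun a h => h.1 rfl⟩
  · rw [← h2.restrict]
    constructor
    · rintro ⟨-, x, y, hx, hy, hxy⟩
      rwa [← e3 x u hx, ← e3 y v hy]
    · intro h
      refine ⟨fun huv => irr (ιt u) ?_, _, _, c₃ u, c₃ v, h⟩
      rwa [← hs.incl_inj huv] at h
  · rw [h1.contract a b hab]
    constructor
    · rintro ⟨x, y, rfl, rfl, hxy⟩
      rw [h2.contract _ _ fun h => hab (congrArg πr h)] at hxy
      obtain ⟨x, y, rfl, rfl, hxy⟩ := hxy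
      refine ⟨πt' x, πt' y, (c₁ x).symm, (c₁ y).symm, fun h => hab ?_, x, y, rfl, rfl, hxy⟩
      rw [c₁, c₁, h]
    · rintro ⟨_, _, rfl, rfl, -, x, y, rfl, rfl, hxy⟩
      refine ⟨πt x, πt y, c₁ x, c₁ y, (h2.contract _ _ fun h => hab ?_).2 ⟨x, y, rfl, rfl, hxy⟩⟩
      rw [← c₁, ← c₁, h]
  · rw [← h1.restrict]
    by_cases huv : u = v
    · subst huv
      simp [irr, h1.restrict, irr₂]
    · rw [h2.contract _ _ fun h => huv (hr.incl_inj h)]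
      constructor
      · exact fun h => ⟨_, _, c₂ u, c₂ v, h⟩
      · rintro ⟨x, y, hx, hy, hxy⟩
        rwa [← e2 x u hx, ← e2 y v hy]
  · exact ⟨fun h => h.2, fun h => ⟨hab, h⟩⟩

/-! ### The operad of directed simple graphs -/

/-- The graph obtained by renaming each vertex `a` as `σ a`. -/
def DSGraph.relabel {n : ℕ} (σ : Equiv.Perm (Fin n)) (g : DSGraph n) : DSGraph n where
  adj a b := g.adj (σ.symm a) (σ.symm b)
  acyclic a h := g.acyclic (σ.symm a) (h.lift σ.symm fun _ _ h => h)
  connected := by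
    let e : SimpleGraph.fromRel g.adj ≃g
        SimpleGraph.fromRel fun a b => g.adj (σ.symm a) (σ.symm b) :=
      ⟨σ, fun {a b} => by simp [SimpleGraph.fromRel_adj]⟩
    exact e.connected_iff.1 g.connected

/-- The graph with one vertex. -/
def DSGraph.point : DSGraph 1 where
  adj _ _ := False
  acyclic a h := by
    obtain ⟨_, _, h⟩ := Relation.TransGen.tail'_iff.1 h
    exact h
  connected :=
    haveI : Subsingleton (Fin 1) := inferInstance
    { preconnected := fun a b => by rw [Subsingleton.elim a b] }

/-- `g` is one of the graphs obtained by inserting `g₂` at the vertex `i` of `g₁`. -/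
def DSGraph.Inserts {m n r : ℕ} (h : r + 1 = m + n) (i : Fin m) (g₁ : DSGraph m) (g₂ : DSGraph n)
    (g : DSGraph r) : Prop :=
  IsInsertion (blockProj h i) (blockIncl h i) g₁.adj g₂.adj g.adj

open Classical in
/-- The partial composition `g₁ ∘_i g₂` of directed simple graphs: the sum of all the graphs obtained
by inserting `g₂` at the vertex `i` of `g₁` and replacing each edge between `i` and another vertex `j`
by edges, in the same direction, between `j` and at least one vertex of `g₂`. -/
noncomputable def DSGraph.insertionSum (k : Type u) [Field k] {m n r : ℕ} (h : r + 1 = m + n)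
    (i : Fin m) (g₁ : DSGraph m) (g₂ : DSGraph n) : DSGraph r →₀ k :=
  ∑ g with DSGraph.Inserts h i g₁ g₂ g, Finsupp.single g 1

/-- The graph with a given irreflexive adjacency relation obtained by insertion. -/
def DSGraph.ofInsertion {m n r : ℕ} (h : r + 1 = m + n) (i : Fin m) (g₁ : DSGraph m)
    (g₂ : DSGraph n) (g : Fin r → Fin r → Prop)
    (hg : IsInsertion (blockProj h i) (blockIncl h i) g₁.adj g₂.adj g) (h0 : ∀ x, ¬ g x x) :
    DSGraph r where
  adj := g
  acyclic := hg.acyclic (isBlock h i) g₁.acyclic g₂.acyclic h0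
  connected := hg.connected (isBlock h i) g₁.connected g₂.connected

theorem DSGraph.Inserts.eq_left {m n r : ℕ} {h : r + 1 = m + n} {i : Fin m} {g₁ g₁' : DSGraph m}
    {g₂ : DSGraph n} {g : DSGraph r} (h1 : DSGraph.Inserts h i g₁ g₂ g)
    (h2 : DSGraph.Inserts h i g₁' g₂ g) : g₁ = g₁' := by
  ext a b
  by_cases hab : a = b
  · subst hab
    simp [DSGraph.irrefl]
  · rw [h1.contract a b hab, h2.contract a b hab]

theorem DSGraph.Inserts.eq_right {m n r : ℕ} {h : r + 1 = m + n} {i : Fin m} {g₁ g₁' : DSGraph m}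
    {g₂ g₂' : DSGraph n} {g : DSGraph r} (h1 : DSGraph.Inserts h i g₁ g₂ g)
    (h2 : DSGraph.Inserts h i g₁' g₂' g) : g₂ = g₂' := by
  ext a b
  rw [← h1.restrict, h2.restrict]

open Classical in
/-- Two double sums over graphs agree if each graph of the result occurs at most once in each, and
occurs in one if and only if it occurs in the other. -/
theorem DSGraph.double_sum_eq (k : Type u) [Field k] {r s t : ℕ}
    (p : DSGraph r → Prop) (q : DSGraph r → DSGraph t → Prop)
    (p' : DSGraph s → Prop) (q' : DSGraph s → DSGraph t → Prop)
    (hq : ∀ a b g, p a → q a g → p b → q b g → a = b)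
    (hq' : ∀ a b g, p' a → q' a g → p' b → q' b g → a = b)
    (hiff : ∀ g, (∃ a, p a ∧ q a g) ↔ ∃ a, p' a ∧ q' a g) :
    ∑ a with p a, ∑ g with q a g, Finsupp.single g (1 : k) =
      ∑ a with p' a, ∑ g with q' a g, Finsupp.single g (1 : k) := by
  have key : ∀ {w : ℕ} (p : DSGraph w → Prop) (q : DSGraph w → DSGraph t → Prop)
      (_ : ∀ a b g, p a → q a g → p b → q b g → a = b),
      ∑ a with p a, ∑ g with q a g, Finsupp.single g (1 : k) =
        ∑ g with (∃ a, p a ∧ q a g), Finsupp.single g (1 : k) := by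
    intro w p q hq
    rw [← Finset.sum_biUnion]
    · congr 1
      ext g
      simp
    · intro a ha b hb hab
      rw [Function.onFun, Finset.disjoint_left]
      intro g hg hg'
      simp only [Finset.coe_filter, Finset.mem_univ, true_and, Set.mem_ofPred_eq,
        Finset.mem_filter] at ha hb hg hg'
      exact hab (hq a b g ha hg hb hg')
  rw [key p q hq, key p' q' hq']
  simp only [hiff]

theorem DSGraph.Inserts.seq_iff {l m n r s t : ℕ} (hr : r + 1 = l + m) (ht : t + 1 = r + n)
    (hs : s + 1 = m + n) (ht' : t + 1 = l + s) (i : Fin l) (j : Fin m)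
    (g₁ : DSGraph l) (g₂ : DSGraph m) (g₃ : DSGraph n) (g : DSGraph t) :
    (∃ g', DSGraph.Inserts hr i g₁ g₂ g' ∧ DSGraph.Inserts ht (blockIncl hr i j) g' g₃ g) ↔
      ∃ g'', DSGraph.Inserts hs j g₂ g₃ g'' ∧ DSGraph.Inserts ht' i g₁ g'' g := by
  have c₁ : ∀ x, blockProj hr i (blockProj ht (blockIncl hr i j) x) = blockProj ht' i x := by
    intro x
    have h1 := blockProj_spec hr i (blockProj ht (blockIncl hr i j) x)
    have h2 := blockProj_spec ht (blockIncl hr i j) x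
    have h3 := blockProj_spec ht' i x
    have h4 := blockIncl_val hr i j
    ext
    omega
  have c₂ : ∀ y, blockProj ht (blockIncl hr i j) (blockIncl ht' i y) =
      blockIncl hr i (blockProj hs j y) := by
    intro y
    have h1 := blockProj_spec ht (blockIncl hr i j) (blockIncl ht' i y)
    have h2 := blockProj_spec hs j y
    have h3 := blockIncl_val hr i j
    have h4 := blockIncl_val ht' i y
    have h5 := blockIncl_val hr i (blockProj hs j y)
    ext
    omega
  have c₃ : ∀ d, blockIncl ht' i (blockIncl hs j d) = blockIncl ht (blockIncl hr i j) d := by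
    intro d
    ext
    simp only [blockIncl]
    omega
  have main := IsInsertion.seq_iff (isBlock hr i) (isBlock ht' i) c₁ c₂ c₃ (g₁ := g₁.adj) (g₃ := g₃.adj) (g := g.adj) g₂.irrefl
  constructor
  · rintro ⟨g', h1, h2⟩
    obtain ⟨g'', h3, h4, h5⟩ := main.1 g'.adj h1 h2
    exact ⟨.ofInsertion hs j g₂ g₃ g'' h3 fun x hx => g.irrefl _ ((h5 x x).1 hx), h3, h4⟩
  · rintro ⟨g'', h1, h2⟩
    obtain ⟨g', h3, h4, h5⟩ := main.2 g''.adj h1 h2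
    exact ⟨.ofInsertion hr i g₁ g₂ g' h3 h5, h3, h4⟩

theorem DSGraph.Inserts.par_iff {l m n r s t : ℕ} (hr : r + 1 = l + m) (ht : t + 1 = r + n)
    (hs : s + 1 = l + n) (ht' : t + 1 = s + m) (i k : Fin l) (hik : i < k)
    (k' : Fin r) (hk' : k'.1 + 1 = k.1 + m) (i' : Fin s) (hi' : i'.1 = i.1)
    (g₁ : DSGraph l) (g₂ : DSGraph m) (g₃ : DSGraph n) (g : DSGraph t) :
    (∃ g', DSGraph.Inserts hr i g₁ g₂ g' ∧ DSGraph.Inserts ht k' g' g₃ g) ↔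
      ∃ g'', DSGraph.Inserts hs k g₁ g₃ g'' ∧ DSGraph.Inserts ht' i' g'' g₂ g := by
  have hik' : i.1 < k.1 := hik
  have c₀ : blockProj hr i k' = k := by
    have h1 := blockProj_spec hr i k'
    ext
    omega
  have c₀' : blockProj hs k i' = i := by
    have h1 := blockProj_spec hs k i'
    ext
    omega
  have c₁ : ∀ x, blockProj hr i (blockProj ht k' x) = blockProj hs k (blockProj ht' i' x) := by
    intro x
    have h1 := blockProj_spec hr i (blockProj ht k' x)
    have h2 := blockProj_spec ht k' x
    have h3 := blockProj_spec hs k (blockProj ht' i' x)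
    have h4 := blockProj_spec ht' i' x
    ext
    omega
  have c₂ : ∀ b, blockProj ht k' (blockIncl ht' i' b) = blockIncl hr i b := by
    intro b
    have h1 := blockProj_spec ht k' (blockIncl ht' i' b)
    have h2 := blockIncl_val ht' i' b
    have h3 := blockIncl_val hr i b
    ext
    omega
  have c₃ : ∀ d, blockProj ht' i' (blockIncl ht k' d) = blockIncl hs k d := by
    intro d
    have h1 := blockProj_spec ht' i' (blockIncl ht k' d)
    have h2 := blockIncl_val ht k' d
    have h3 := blockIncl_val hs k d
    ext
    omega
  constructor
  · rintro ⟨g', h1, h2⟩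
    obtain ⟨g'', h3, h4, h5⟩ := IsInsertion.par hik.ne (isBlock hr i) (isBlock hs k)
      (isBlock ht k') (isBlock ht' i') c₀ c₀' c₁ c₂ c₃ g.irrefl g₂.irrefl g'.adj h1 h2
    exact ⟨.ofInsertion hs k g₁ g₃ g'' h3 h5, h3, h4⟩
  · rintro ⟨g'', h1, h2⟩
    obtain ⟨g', h3, h4, h5⟩ := IsInsertion.par hik.ne' (isBlock hs k) (isBlock hr i)
      (isBlock ht' i') (isBlock ht k') c₀' c₀ (fun x => (c₁ x).symm) c₃ c₂ g.irrefl g₃.irrefl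
      g''.adj h1 h2
    exact ⟨.ofInsertion hr i g₁ g₂ g' h3 h5, h3, h4⟩

theorem DSGraph.inserts_relabel {m n r : ℕ} (h : r + 1 = m + n) (i : Fin m)
    (σ : Equiv.Perm (Fin m)) (τ : Equiv.Perm (Fin n)) (ρ : Equiv.Perm (Fin r))
    (hρ : IsBlockPerm h i σ τ ρ) (g₁ : DSGraph m) (g₂ : DSGraph n) (g : DSGraph r) :
    DSGraph.Inserts h (σ i) (g₁.relabel σ) (g₂.relabel τ) (g.relabel ρ) ↔
      DSGraph.Inserts h i g₁ g₂ g := by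
  have e1 : ∀ u, ρ.symm (blockIncl h (σ i) u) = blockIncl h i (τ.symm u) := by
    intro u
    rw [Equiv.symm_apply_eq, hρ.incl, Equiv.apply_symm_apply]
  constructor
  · rintro ⟨h1, h2⟩
    refine ⟨fun u v => ?_, fun a b hab => ?_⟩
    · simpa [DSGraph.relabel, e1] using h1 (τ u) (τ v)
    · have := h2 (σ a) (σ b) (by simpa using hab)
      simp only [DSGraph.relabel, Equiv.symm_apply_apply] at this
      rw [this]
      constructor
      · rintro ⟨x, y, hx, hy, hxy⟩
        refine ⟨ρ.symm x, ρ.symm y, ?_, ?_, hxy⟩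
        · rw [← σ.injective.eq_iff, ← hρ.proj, Equiv.apply_symm_apply, hx]
        · rw [← σ.injective.eq_iff, ← hρ.proj, Equiv.apply_symm_apply, hy]
      · rintro ⟨x, y, rfl, rfl, hxy⟩
        exact ⟨ρ x, ρ y, hρ.proj x, hρ.proj y, by simpa using hxy⟩
  · rintro ⟨h1, h2⟩
    refine ⟨fun u v => ?_, fun a b hab => ?_⟩
    · simpa [DSGraph.relabel, e1] using h1 (τ.symm u) (τ.symm v)
    · have := h2 (σ.symm a) (σ.symm b) (by simpa using hab)
      simp only [DSGraph.relabel]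
      rw [this]
      constructor
      · rintro ⟨x, y, hx, hy, hxy⟩
        refine ⟨ρ x, ρ y, ?_, ?_, by simpa using hxy⟩
        · rw [hρ.proj, hx, Equiv.apply_symm_apply]
        · rw [hρ.proj, hy, Equiv.apply_symm_apply]
      · rintro ⟨x, y, rfl, rfl, hxy⟩
        refine ⟨ρ.symm x, ρ.symm y, ?_, ?_, hxy⟩
        · rw [Equiv.eq_symm_apply, ← hρ.proj, Equiv.apply_symm_apply]
        · rw [Equiv.eq_symm_apply, ← hρ.proj, Equiv.apply_symm_apply]

/-- The bilinear extension of the partial composition of graphs. -/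
noncomputable def LieGra.circ (k : Type u) [Field k] {m n r : ℕ} (h : r + 1 = m + n) (i : Fin m) :
    (DSGraph m →₀ k) →ₗ[k] (DSGraph n →₀ k) →ₗ[k] (DSGraph r →₀ k) :=
  Finsupp.linearCombination k fun g₁ =>
    Finsupp.linearCombination k fun g₂ => DSGraph.insertionSum k h i g₁ g₂

theorem LieGra.circ_single (k : Type u) [Field k] {m n r : ℕ} (h : r + 1 = m + n) (i : Fin m)
    (g₁ : DSGraph m) (g₂ : DSGraph n) :
    LieGra.circ k h i (Finsupp.single g₁ 1) (Finsupp.single g₂ 1) =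
      DSGraph.insertionSum k h i g₁ g₂ := by
  simp [LieGra.circ]

theorem LieGra.span_induction (k : Type u) [Field k] {n : ℕ} {p : (DSGraph n →₀ k) → Prop}
    (hadd : ∀ x y, p x → p y → p (x + y)) (hsmul : ∀ (c : k) x, p x → p (c • x)) (hzero : p 0)
    (hsingle : ∀ g, p (Finsupp.single g 1)) (x : DSGraph n →₀ k) : p x := by
  induction x using Finsupp.induction_linear with
  | zero => exact hzero
  | add x y hx hy => exact hadd x y hx hy
  | single g c =>
    have := hsmul c _ (hsingle g)
    rwa [Finsupp.smul_single, smul_eq_mul, mul_one] at this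

open Classical in
theorem LieGra.circ_seq (k : Type u) [Field k] {l m n r s t : ℕ} (hr : r + 1 = l + m)
    (ht : t + 1 = r + n) (hs : s + 1 = m + n) (ht' : t + 1 = l + s) (i : Fin l) (j : Fin m)
    (x : DSGraph l →₀ k) (y : DSGraph m →₀ k) (z : DSGraph n →₀ k) :
    LieGra.circ k ht (blockIncl hr i j) (LieGra.circ k hr i x y) z =
      LieGra.circ k ht' i x (LieGra.circ k hs j y z) := by
  induction x using LieGra.span_induction with
  | hadd _ _ h h' => simp only [map_add, LinearMap.add_apply, h, h']
  | hsmul _ _ h => simp only [map_smul, LinearMap.smul_apply, h]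
  | hzero => simp only [map_zero, LinearMap.zero_apply]
  | hsingle g₁ =>
  induction y using LieGra.span_induction with
  | hadd _ _ h h' => simp only [map_add, LinearMap.add_apply, h, h']
  | hsmul _ _ h => simp only [map_smul, LinearMap.smul_apply, h]
  | hzero => simp only [map_zero, LinearMap.zero_apply]
  | hsingle g₂ =>
  induction z using LieGra.span_induction with
  | hadd _ _ h h' => simp only [map_add, h, h']
  | hsmul _ _ h => simp only [map_smul, h]
  | hzero => simp only [map_zero]
  | hsingle g₃ =>
  simp only [LieGra.circ_single]
  simp only [DSGraph.insertionSum, map_sum, LinearMap.sum_apply, LieGra.circ_single]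
  exact DSGraph.double_sum_eq k _ (fun g' g => DSGraph.Inserts ht (blockIncl hr i j) g' g₃ g) _
    (fun g'' g => DSGraph.Inserts ht' i g₁ g'' g) (fun _ _ _ _ h _ h' => h.eq_left h')
    (fun _ _ _ _ h _ h' => h.eq_right h')
    fun g => DSGraph.Inserts.seq_iff hr ht hs ht' i j g₁ g₂ g₃ g

open Classical in
theorem LieGra.circ_par (k : Type u) [Field k] {l m n r s t : ℕ} (hr : r + 1 = l + m)
    (ht : t + 1 = r + n) (hs : s + 1 = l + n) (ht' : t + 1 = s + m) (i j : Fin l) (hij : i < j)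
    (j' : Fin r) (hj' : j'.1 + 1 = j.1 + m) (i' : Fin s) (hi' : i'.1 = i.1)
    (x : DSGraph l →₀ k) (y : DSGraph m →₀ k) (z : DSGraph n →₀ k) :
    LieGra.circ k ht j' (LieGra.circ k hr i x y) z =
      LieGra.circ k ht' i' (LieGra.circ k hs j x z) y := by
  induction x using LieGra.span_induction with
  | hadd _ _ h h' => simp only [map_add, LinearMap.add_apply, h, h']
  | hsmul _ _ h => simp only [map_smul, LinearMap.smul_apply, h]
  | hzero => simp only [map_zero, LinearMap.zero_apply]
  | hsingle g₁ =>
  induction y using LieGra.span_induction with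
  | hadd _ _ h h' => simp only [map_add, LinearMap.add_apply, h, h']
  | hsmul _ _ h => simp only [map_smul, LinearMap.smul_apply, h]
  | hzero => simp only [map_zero, LinearMap.zero_apply]
  | hsingle g₂ =>
  induction z using LieGra.span_induction with
  | hadd _ _ h h' => simp only [map_add, LinearMap.add_apply, h, h']
  | hsmul _ _ h => simp only [map_smul, LinearMap.smul_apply, h]
  | hzero => simp only [map_zero, LinearMap.zero_apply]
  | hsingle g₃ =>
  simp only [LieGra.circ_single]
  simp only [DSGraph.insertionSum, map_sum, LinearMap.sum_apply, LieGra.circ_single]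
  exact DSGraph.double_sum_eq k _ (fun g' g => DSGraph.Inserts ht j' g' g₃ g) _
    (fun g'' g => DSGraph.Inserts ht' i' g'' g₂ g) (fun _ _ _ _ h _ h' => h.eq_left h')
    (fun _ _ _ _ h _ h' => h.eq_left h')
    fun g => DSGraph.Inserts.par_iff hr ht hs ht' i j hij j' hj' i' hi' g₁ g₂ g₃ g

/-- The action of the symmetric groups on the labels of the vertices. -/
noncomputable def LieGra.act (k : Type u) [Field k] (n : ℕ) :
    Representation k (Equiv.Perm (Fin n)) (DSGraph n →₀ k) where
  toFun σ := Finsupp.lmapDomain k k (DSGraph.relabel σ)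
  map_one' := by
    have : DSGraph.relabel (1 : Equiv.Perm (Fin n)) = id := rfl
    rw [this, Finsupp.lmapDomain_id]
    rfl
  map_mul' σ τ := by
    have : DSGraph.relabel (σ * τ) = DSGraph.relabel σ ∘ DSGraph.relabel τ := rfl
    rw [this, Finsupp.lmapDomain_comp]
    rfl

theorem LieGra.act_single (k : Type u) [Field k] {n : ℕ} (σ : Equiv.Perm (Fin n))
    (g : DSGraph n) (c : k) :
    LieGra.act k n σ (Finsupp.single g c) = Finsupp.single (g.relabel σ) c :=
  Finsupp.mapDomain_single

/-- Renaming the vertices is a bijection on graphs. -/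
def DSGraph.relabelEquiv {n : ℕ} (σ : Equiv.Perm (Fin n)) : DSGraph n ≃ DSGraph n where
  toFun := DSGraph.relabel σ
  invFun := DSGraph.relabel σ.symm
  left_inv g := by
    ext a b
    simp [DSGraph.relabel]
  right_inv g := by
    ext a b
    simp [DSGraph.relabel]

open Classical in
theorem LieGra.circ_act (k : Type u) [Field k] {m n r : ℕ} (h : r + 1 = m + n) (i : Fin m)
    (σ : Equiv.Perm (Fin m)) (τ : Equiv.Perm (Fin n)) (ρ : Equiv.Perm (Fin r))
    (hρ : IsBlockPerm h i σ τ ρ) (x : DSGraph m →₀ k) (y : DSGraph n →₀ k) :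
    LieGra.circ k h (σ i) (LieGra.act k m σ x) (LieGra.act k n τ y) =
      LieGra.act k r ρ (LieGra.circ k h i x y) := by
  induction x using LieGra.span_induction with
  | hadd _ _ h h' => simp only [map_add, LinearMap.add_apply, h, h']
  | hsmul _ _ h => simp only [map_smul, LinearMap.smul_apply, h]
  | hzero => simp only [map_zero, LinearMap.zero_apply]
  | hsingle g₁ =>
  induction y using LieGra.span_induction with
  | hadd _ _ h h' => simp only [map_add, h, h']
  | hsmul _ _ h => simp only [map_smul, h]
  | hzero => simp only [map_zero]
  | hsingle g₂ =>
  simp only [LieGra.act_single, LieGra.circ_single]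
  simp only [DSGraph.insertionSum, map_sum, LieGra.act_single]
  symm
  refine Finset.sum_equiv (DSGraph.relabelEquiv ρ) (fun g => ?_) fun g _ => rfl
  simp only [Finset.mem_filter, Finset.mem_univ, true_and]
  exact (DSGraph.inserts_relabel h i σ τ ρ hρ g₁ g₂ g).symm

open Classical in
theorem LieGra.one_circ (k : Type u) [Field k] {n : ℕ} (h : n + 1 = 1 + n) (x : DSGraph n →₀ k) :
    LieGra.circ k h 0 (Finsupp.single DSGraph.point 1) x = x := by
  induction x using LieGra.span_induction with
  | hadd _ _ h h' => simp only [map_add, h, h']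
  | hsmul _ _ h => simp only [map_smul, h]
  | hzero => simp only [map_zero]
  | hsingle g =>
  have e : ∀ u, blockIncl h 0 u = u := fun u => by
    ext
    simp [blockIncl]
  have : ∀ g', DSGraph.Inserts h 0 DSGraph.point g g' ↔ g' = g := by
    intro g'
    constructor
    · intro hg
      ext a b
      rw [← hg.restrict, e, e]
    · rintro rfl
      exact ⟨fun u v => by rw [e, e], fun a b hab => absurd (Subsingleton.elim a b) hab⟩
  rw [LieGra.circ_single, DSGraph.insertionSum]
  simp [this, Finset.sum_filter]

open Classical in
theorem LieGra.circ_one (k : Type u) [Field k] {n : ℕ} (h : n + 1 = n + 1) (i : Fin n)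
    (x : DSGraph n →₀ k) : LieGra.circ k h i x (Finsupp.single DSGraph.point 1) = x := by
  induction x using LieGra.span_induction with
  | hadd _ _ h h' => simp only [map_add, LinearMap.add_apply, h, h']
  | hsmul _ _ h => simp only [map_smul, LinearMap.smul_apply, h]
  | hzero => simp only [map_zero, LinearMap.zero_apply]
  | hsingle g =>
  have e : ∀ x, blockProj h i x = x := fun x => by
    have h1 := blockProj_spec h i x
    ext
    omega
  have : ∀ g', DSGraph.Inserts h i g DSGraph.point g' ↔ g' = g := by
    intro g'
    constructor
    · intro hg
      ext a b
      by_cases hab : a = b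
      · subst hab
        simp [DSGraph.irrefl]
      · rw [hg.contract a b hab]
        simp [e]
    · rintro rfl
      refine ⟨fun u v => ?_, fun a b _ => by simp [e]⟩
      rw [Subsingleton.elim u v]
      exact iff_of_false (g'.irrefl _) (DSGraph.point.irrefl _)
  rw [LieGra.circ_single, DSGraph.insertionSum]
  simp [this, Finset.sum_filter]

/-- The operad `Lie-gra`: its operations of arity `n` are the linear combinations of directed simple
graphs with vertices labelled by `Fin n`, the symmetric groups act on the labels, the partial
compositions are given by insertion, and the unit is the graph with one vertex. -/
noncomputable def LieGra (k : Type u) [Field k] : SymmOperad k where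
  obj n := DSGraph n →₀ k
  act n := LieGra.act k n
  one := Finsupp.single DSGraph.point 1
  circ h i := LieGra.circ k h i
  one_circ h x := LieGra.one_circ k h x
  circ_one h i x := LieGra.circ_one k h i x
  seq_assoc hr ht hs ht' i j x y z := LieGra.circ_seq k hr ht hs ht' i j x y z
  par_assoc hr ht hs ht' i j hij j' hj' i' hi' x y z :=
    LieGra.circ_par k hr ht hs ht' i j hij j' hj' i' hi' x y z
  circ_act h i σ τ ρ hρ x y := LieGra.circ_act k h i σ τ ρ hρ x y

/-! The obstruction is growth. If finitely many operations of arity at least `2` generate an operad,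
its dimension in arity `r` is at most `r! (r C) ^ r` for a constant `C`, that is, `2` to the power
`O(r log r)`. The number of directed simple graphs on `r` vertices is `2` to a power quadratic in
`r`, so no finite set of generators can suffice.

For the upper bound, sequential associativity rewrites `x ∘ (y ∘ g)` as `(x ∘ y) ∘ g`, and
equivariance moves permutations to the outside. Hence every operation is a linear combination of
relabelled combs, in which single generators are inserted one after another
(`SymmOperad.combSpan_circ`, `SymmOperad.combSpan_eq_top`). Each insertion raises the arity, so a
comb of arity `r` has fewer than `r` insertions, each given by a generator and one of at most `r`
positions (`SymmOperad.exists_finset_comb`). The relabellings contribute the factor `r!`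
(`SymmOperad.finrank_le_of_combSpan_eq_top`).

A generating module of finite total dimension vanishes above some arity `N`, so its image lies in
the span of the finitely many graphs with at most `N` vertices. Those with at least two vertices
serve as generators, and the one-vertex graph is the unit.

For the lower bound, any relation between two sets of `s` vertices can be encoded in a graph on `2 s
+ 1` vertices, the extra vertex ensuring connectedness (`DSGraph.ofRel_injective`). This gives at
least `2 ^ (s * s)` graphs, which exceeds the upper bound for a suitable `s`. -/

/-! ### Right combs in an operad -/

/-- The iterated composites `((one ∘ g₁) ∘ g₂) ∘ ⋯` of operations `gⱼ` in `G`. -/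
inductive SymmOperad.Comb {k : Type u} [Field k] (P : SymmOperad k)
    (G : ∀ n, Finset (P.obj n)) : ∀ n, P.obj n → Prop
  | one : SymmOperad.Comb P G 1 P.one
  | circ {m n r : ℕ} (h : r + 1 = m + n) (i : Fin m) (x : P.obj m) (g : P.obj n) (hg : g ∈ G n)
      (hx : SymmOperad.Comb P G m x) : SymmOperad.Comb P G r (P.circ h i x g)

/-- The span of all relabellings of combs. -/
def SymmOperad.combSpan {k : Type u} [Field k] (P : SymmOperad k)
    (G : ∀ n, Finset (P.obj n)) (n : ℕ) : Submodule k (P.obj n) :=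
  Submodule.span k {y | ∃ (σ : Equiv.Perm (Fin n)) (x : P.obj n), P.Comb G n x ∧ P.act n σ x = y}

/-! ### The relabelled combs span a suboperad. -/

section CombSpan

variable {k : Type u} [Field k] {P : SymmOperad k} {G : ∀ n, Finset (P.obj n)}

theorem SymmOperad.Comb.act_mem {n : ℕ} {x : P.obj n} (hx : P.Comb G n x)
    (σ : Equiv.Perm (Fin n)) : P.act n σ x ∈ P.combSpan G n :=
  Submodule.subset_span ⟨σ, x, hx, rfl⟩

theorem SymmOperad.Comb.mem {n : ℕ} {x : P.obj n} (hx : P.Comb G n x) : x ∈ P.combSpan G n := by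
  simpa using hx.act_mem 1

theorem SymmOperad.combSpan_act {n : ℕ} (σ : Equiv.Perm (Fin n)) {x : P.obj n}
    (hx : x ∈ P.combSpan G n) : P.act n σ x ∈ P.combSpan G n := by
  induction hx using Submodule.span_induction with
  | mem y hy =>
    obtain ⟨τ, x, hx, rfl⟩ := hy
    rw [← Module.End.mul_apply, ← map_mul]
    exact hx.act_mem _
  | zero => simp
  | add x y _ _ hx hy => simpa using add_mem hx hy
  | smul c x _ hx => simpa using Submodule.smul_mem _ c hx

/-- By equivariance, inserting `g` at `i` in a comb relabelled by `σ` is a relabelling, by a block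
permutation, of the comb obtained by inserting `g` at `σ.symm i`. -/
theorem SymmOperad.combSpan_circ_gen {m n r : ℕ} (h : r + 1 = m + n) (i : Fin m) {x : P.obj m}
    (hx : x ∈ P.combSpan G m) {g : P.obj n} (hg : g ∈ G n) :
    P.circ h i x g ∈ P.combSpan G r := by
  induction hx using Submodule.span_induction with
  | mem y hy =>
    obtain ⟨σ, x, hx, rfl⟩ := hy
    obtain ⟨ρ, hρ, -⟩ := existsUnique_isBlockPerm h (σ.symm i) σ 1
    have := P.circ_act h (σ.symm i) σ 1 ρ hρ x g
    rw [Equiv.apply_symm_apply, map_one, Module.End.one_apply] at this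
    rw [this]
    exact (SymmOperad.Comb.circ h _ x g hg hx).act_mem ρ
  | zero => simp
  | add x y _ _ hx hy => simpa using add_mem hx hy
  | smul c x _ hx => simpa using Submodule.smul_mem _ c hx

/-- Induction on the comb `y`, peeling off its last generator with the sequential axiom. The
parallel axiom plays no role, because a comb may insert its generators at any positions in any
order. -/
theorem SymmOperad.combSpan_circ_comb {n : ℕ} {y : P.obj n} (hy : P.Comb G n y) :
    ∀ {m r : ℕ} (h : r + 1 = m + n) (i : Fin m) {x : P.obj m}, x ∈ P.combSpan G m →
      P.circ h i x y ∈ P.combSpan G r := by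
  induction hy with
  | one =>
    intro m r h i x hx
    obtain rfl : r = m := by omega
    rwa [P.circ_one]
  | @circ m' n' r' h' j w g hg _ ih =>
    intro m r h i x hx
    have hi := i.2
    have e : (m + m' - 1) + 1 = m + m' := by omega
    rw [← P.seq_assoc e (by omega) h' h i j]
    exact SymmOperad.combSpan_circ_gen _ _ (ih e i hx) hg

/-- Linearity reduces to a relabelled comb `y`; equivariance with the identity on the outer labels
takes the relabelling out of the composite. -/
theorem SymmOperad.combSpan_circ {m n r : ℕ} (h : r + 1 = m + n) (i : Fin m) {x : P.obj m}
    (hx : x ∈ P.combSpan G m) {y : P.obj n} (hy : y ∈ P.combSpan G n) :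
    P.circ h i x y ∈ P.combSpan G r := by
  induction hy using Submodule.span_induction with
  | mem y hy =>
    obtain ⟨τ, y, hy, rfl⟩ := hy
    obtain ⟨ρ, hρ, -⟩ := existsUnique_isBlockPerm h i 1 τ
    have := P.circ_act h i 1 τ ρ hρ x y
    rw [Equiv.Perm.one_apply, map_one, Module.End.one_apply] at this
    rw [this]
    exact SymmOperad.combSpan_act ρ (SymmOperad.combSpan_circ_comb hy h i hx)
  | zero => simp
  | add x y _ _ hx hy => simpa using add_mem hx hy
  | smul c x _ hx => simpa using Submodule.smul_mem _ c hx

theorem SymmOperad.gen_mem_combSpan {n : ℕ} {g : P.obj n} (hg : g ∈ G n) :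
    g ∈ P.combSpan G n := by
  have := SymmOperad.Comb.circ (add_comm n 1) 0 P.one g hg .one
  rw [P.one_circ] at this
  exact this.mem

/-- The comb span contains the unit and is stable under all the operations from which formal
expressions are built, so it contains every value as soon as it contains the values of the
generators. -/
theorem FreeOperad.eval_mem_combSpan {E : SymmModule k} (φ : SymmModule.Hom E P.toSymmModule)
    (hφ : ∀ n e, φ.map n e ∈ P.combSpan G n) {n : ℕ} (t : FreeOperad.Term E n) :
    FreeOperad.eval φ t ∈ P.combSpan G n := by
  induction t with
  | of n e => exact hφ n e
  | zero n => exact zero_mem _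
  | add x y hx hy => exact add_mem hx hy
  | smul c x hx => exact Submodule.smul_mem _ c hx
  | act σ x hx => exact SymmOperad.combSpan_act σ hx
  | one => exact SymmOperad.Comb.one.mem
  | circ h i x y hx hy => exact SymmOperad.combSpan_circ h i hx hy

/-- If `𝒯(E) → P` is surjective and maps `E` into the span of the combs, then the combs span. -/
theorem SymmOperad.combSpan_eq_top {E : SymmModule k} (f : SymmOperad.Hom (freeOperad E) P)
    (hf : ∀ n, Function.Surjective (f.map n))
    (hE : ∀ n e, f.map n ((FreeOperad.incl E).map n e) ∈ P.combSpan G n) (n : ℕ) :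
    P.combSpan G n = ⊤ := by
  let φ : SymmModule.Hom E P.toSymmModule :=
    { map := fun n => f.map n ∘ₗ (FreeOperad.incl E).map n
      map_act := fun n σ x => by
        rw [LinearMap.comp_apply, (FreeOperad.incl E).map_act, f.map_act]
        rfl }
  -- Uniqueness in the universal property turns every value of `f` into the evaluation of a formal
  -- expression.
  have hfφ : f = FreeOperad.lift φ :=
    (FreeOperad.existsUnique_lift φ).unique (fun _ _ => rfl) fun _ _ => rfl
  rw [eq_top_iff]
  rintro y -
  obtain ⟨⟨t⟩, rfl⟩ := hf n y
  rw [hfφ]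
  exact FreeOperad.eval_mem_combSpan φ hE t

/-! ### Counting combs. -/

open Classical in
/-- There are at most `(r K) ^ r` combs of arity `r`, where `K` is the number of operations in `G`,
provided that these have arities between `2` and `N`. -/
theorem SymmOperad.exists_finset_comb (N : ℕ) (hG : ∀ n, ∀ g ∈ G n, 2 ≤ n ∧ n ≤ N) (r : ℕ) :
    ∃ S : Finset (P.obj r), (∀ x, P.Comb G r x → x ∈ S) ∧
      S.card ≤ (r * (1 + ∑ n ∈ Finset.range (N + 1), (G n).card)) ^ r := by
  set K := ∑ n ∈ Finset.range (N + 1), (G n).card with hK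
  induction r using Nat.strong_induction_on with
  | _ r ih =>
  -- The values chosen for `S` in arities at least `r` are arbitrary and are never used.
  choose! S hS hcard using ih
  -- The last insertion of a comb, with a natural number as position so that all positions range
  -- over one finite set. The value `0` for inadmissible data only adds harmless elements to the
  -- image.
  let step : ∀ n, P.obj n → ℕ → P.obj (r + 1 - n) → P.obj r := fun n g i x =>
    if h : r + 1 = (r + 1 - n) + n ∧ i < r + 1 - n then P.circ h.1 ⟨i, h.2⟩ x g else 0
  let T : Finset (P.obj r) := (Finset.range (N + 1)).biUnion fun n => (G n).biUnion fun g =>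
    (Finset.range r).biUnion fun i => (S (r + 1 - n)).image (step n g i)
  -- The trivial comb exists only in arity `1`.
  let one : Finset (P.obj r) := if h : 1 = r then {h ▸ P.one} else ∅
  have hone : one.card ≤ 1 := by
    dsimp only [one]
    split_ifs <;> simp
  refine ⟨one ∪ T, fun x hx => ?_, ?_⟩
  · cases hx with
    | one => simp [one]
    | @circ m n _ h i y g hg hy =>
      obtain ⟨h2, hN⟩ := hG n g hg
      obtain rfl : m = r + 1 - n := by omega
      have hi := i.2
      refine Finset.mem_union_right _ ?_
      simp only [T, Finset.mem_biUnion, Finset.mem_range, Finset.mem_image]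
      refine ⟨n, by omega, g, hg, i, by omega, y, hS _ (by omega) _ hy, ?_⟩
      dsimp only [step]
      rw [dif_pos ⟨h, i.2⟩]
  -- Arity `0` is separate because the main estimate uses the exponent `r - 1`; there are no combs
  -- there, while the bound is `0 ^ 0 = 1`.
  · rcases Nat.eq_zero_or_pos r with rfl | hr
    · have h1 : one = ∅ := rfl
      have h2 : T = ∅ := Finset.eq_empty_of_forall_notMem fun x hx => by
        simp only [T, Finset.mem_biUnion, Finset.range_zero] at hx
        obtain ⟨_, _, _, _, _, hi, _⟩ := hx
        exact absurd hi (Finset.notMem_empty _)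
      simp [h1, h2]
    have hpos : 0 < r * (1 + K) := Nat.mul_pos hr (by omega)
    obtain ⟨B, hB⟩ : ∃ B, B = (r * (1 + K)) ^ (r - 1) := ⟨_, rfl⟩
    have hB1 : 1 ≤ B := hB ▸ Nat.one_le_pow _ _ hpos
    -- Since `n ≥ 2`, the comb before the last insertion has arity at most `r - 1`, so the single
    -- bound `B` serves for all generators.
    have hstep : ∀ n, ∀ g ∈ G n, ∀ i, ((S (r + 1 - n)).image (step n g i)).card ≤ B := by
      intro n g hg i
      have h2 := (hG n g hg).1
      refine Finset.card_image_le.trans ((hcard _ (by omega)).trans ?_)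
      rw [hB]
      exact (Nat.pow_le_pow_left (Nat.mul_le_mul_right _ (by omega)) _).trans
        (Nat.pow_le_pow_right hpos (by omega))
    have hT : T.card ≤ K * (r * B) := by
      rw [hK, Finset.sum_mul]
      refine Finset.card_biUnion_le.trans (Finset.sum_le_sum fun n _ => ?_)
      refine Finset.card_biUnion_le_card_mul _ _ _ fun g hg => ?_
      refine (Finset.card_biUnion_le_card_mul _ _ B fun i _ => hstep n g hg i).trans ?_
      rw [Finset.card_range]
    calc (one ∪ T).card ≤ 1 + K * (r * B) := (Finset.card_union_le _ _).trans (by omega)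
      -- The summand `1` of `1 + K` absorbs the trivial comb.
      _ ≤ r * B + K * (r * B) := by
        have := Nat.mul_le_mul hr hB1
        omega
      _ = (r * (1 + K)) ^ (r - 1) * (r * (1 + K)) := by rw [← hB]; ring
      _ = (r * (1 + K)) ^ r := by rw [← pow_succ, Nat.sub_add_cancel hr]

-- A spanning set is given by the at most `r!` relabellings of each comb of arity `r`.
open Classical in
theorem SymmOperad.finrank_le_of_combSpan_eq_top (N : ℕ)
    (hG : ∀ n, ∀ g ∈ G n, 2 ≤ n ∧ n ≤ N) {r : ℕ} (htop : P.combSpan G r = ⊤) :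
    Module.finrank k (P.obj r) ≤
      r.factorial * (r * (1 + ∑ n ∈ Finset.range (N + 1), (G n).card)) ^ r := by
  obtain ⟨S, hS, hcard⟩ := SymmOperad.exists_finset_comb N hG r
  let T : Finset (P.obj r) := Finset.univ.biUnion fun σ : Equiv.Perm (Fin r) => S.image (P.act r σ)
  have hT : T.card ≤ r.factorial * S.card := by
    refine (Finset.card_biUnion_le_card_mul _ _ _ fun σ _ => Finset.card_image_le).trans ?_
    rw [Finset.card_univ, Fintype.card_perm, Fintype.card_fin]
  have hspan : Submodule.span k (T : Set (P.obj r)) = ⊤ := by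
    rw [eq_top_iff, ← htop, SymmOperad.combSpan]
    refine Submodule.span_mono ?_
    rintro _ ⟨σ, x, hx, rfl⟩
    simp only [T, Finset.mem_coe, Finset.mem_biUnion, Finset.mem_image]
    exact ⟨σ, Finset.mem_univ _, x, hS x hx, rfl⟩
  have := finrank_span_finset_le_card (R := k) T
  rw [Set.finrank, hspan, finrank_top] at this
  exact this.trans (hT.trans (Nat.mul_le_mul_left _ hcard))

end CombSpan

/-! ### Generators of bounded arity -/

/-- A sequence of vector spaces of finite total dimension vanishes in large degrees. -/
theorem DirectSum.exists_forall_eq_zero_of_finite {k : Type*} [Field k] (M : ℕ → Type*)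
    [∀ n, AddCommGroup (M n)] [∀ n, Module k (M n)] [Module.Finite k (DirectSum ℕ M)] :
    ∃ N, ∀ n, N < n → ∀ x : M n, x = 0 := by
  classical
  obtain ⟨S, hS⟩ := Module.Finite.fg_top (R := k) (M := DirectSum ℕ M)
  -- The bound is the largest degree in the supports of finitely many generators. Beyond it, the
  -- projection to a component kills all generators, hence everything.
  refine ⟨S.sup fun x => (DFinsupp.support x).sup id, fun n hn x => ?_⟩
  have hle : Submodule.span k (S : Set (DirectSum ℕ M)) ≤
      LinearMap.ker (DirectSum.component k ℕ M n) := by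
    rw [Submodule.span_le]
    intro y hy
    by_contra hne
    have h1 : n ∈ DFinsupp.support y := DFinsupp.mem_support_iff.2 hne
    have h2 : n ≤ (DFinsupp.support y).sup id := Finset.le_sup (f := id) h1
    have h3 := Finset.le_sup (f := fun x : DirectSum ℕ M => (DFinsupp.support x).sup id) hy
    exact absurd hn (not_lt.2 (h2.trans h3))
  have : DirectSum.lof k ℕ M n x ∈ LinearMap.ker (DirectSum.component k ℕ M n) :=
    hle (hS ▸ Submodule.mem_top)
  rwa [LinearMap.mem_ker, DirectSum.component.lof_self] at this

/-- All graphs with between `2` and `N` vertices. -/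
noncomputable def LieGra.smallGraphs (k : Type u) [Field k] (N n : ℕ) :
    Finset (DSGraph n →₀ k) :=
  if 2 ≤ n ∧ n ≤ N then
    Finset.univ.map ⟨fun g => Finsupp.single g 1, Finsupp.single_left_injective one_ne_zero⟩
  else ∅

theorem LieGra.smallGraphs_arity (k : Type u) [Field k] (N n : ℕ) (g : DSGraph n →₀ k)
    (hg : g ∈ LieGra.smallGraphs k N n) : 2 ≤ n ∧ n ≤ N := by
  by_contra h
  simp [LieGra.smallGraphs, h] at hg

/-- Arity `0` has no connected graph and arity `1` only the unit, which is a comb already; from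
arity `2` on, the basis graphs are themselves chosen as generators. Excluding arity `1` is what lets
every insertion raise the arity. -/
theorem LieGra.mem_combSpan_smallGraphs (k : Type u) [Field k] {N n : ℕ} (hn : n ≤ N)
    (x : DSGraph n →₀ k) :
    x ∈ (LieGra k).combSpan (LieGra.smallGraphs k N) n := by
  induction x using LieGra.span_induction with
  | hadd x y hx hy => exact add_mem hx hy
  | hsmul c x hx => exact Submodule.smul_mem _ c hx
  | hzero => exact zero_mem _
  | hsingle g =>
  obtain rfl | rfl | h2 : n = 0 ∨ n = 1 ∨ 2 ≤ n := by omega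
  · exact (g.connected.nonempty.some).elim0
  · have hg : g = DSGraph.point := by
      ext a b
      rw [Subsingleton.elim a b]
      exact iff_of_false (g.irrefl _) (DSGraph.point.irrefl _)
    rw [hg]
    exact SymmOperad.Comb.one.mem
  · refine SymmOperad.gen_mem_combSpan ?_
    rw [LieGra.smallGraphs, if_pos ⟨h2, hn⟩]
    exact Finset.mem_map_of_mem _ (Finset.mem_univ g)

/-! ### Many directed simple graphs -/

/-- The graph on `0, …, 2 s` in which `s` is joined to all the other vertices, and the vertices less
than `s` are joined to those greater than `s` by the relation `R`. -/
def DSGraph.ofRel {s : ℕ} (R : Fin s → Fin s → Prop) : DSGraph (2 * s + 1) where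
  -- Edges increase labels, which excludes directed cycles whatever `R` is; the hub `s` makes the
  -- graph connected.
  adj x y := x < y ∧ (x.1 = s ∨ y.1 = s ∨ ∃ a b, R a b ∧ x.1 = a.1 ∧ y.1 = s + 1 + b.1)
  acyclic a h := by
    have key : ∀ b, Relation.TransGen (fun x y : Fin (2 * s + 1) => x < y ∧
        (x.1 = s ∨ y.1 = s ∨ ∃ a b, R a b ∧ x.1 = a.1 ∧ y.1 = s + 1 + b.1)) a b → a < b := by
      intro b hb
      induction hb with
      | single h => exact h.1
      | tail _ h ih => exact ih.trans h.1
    exact lt_irrefl a (key a h)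
  connected := by
    have : Nonempty (Fin (2 * s + 1)) := ⟨0⟩
    refine SimpleGraph.connected_iff_exists_forall_reachable _ |>.2 ⟨⟨s, by omega⟩, fun x => ?_⟩
    by_cases hx : (⟨s, by omega⟩ : Fin (2 * s + 1)) = x
    · rw [hx]
    · refine SimpleGraph.Adj.reachable ?_
      rw [SimpleGraph.fromRel_adj]
      refine ⟨hx, ?_⟩
      rcases lt_or_gt_of_ne hx with h | h
      · exact .inl ⟨h, .inl rfl⟩
      · exact .inr ⟨h, .inr (.inl rfl)⟩

/-- Neither `a` nor `s + 1 + b` is the hub, so an edge between them can only come from `R a b`, and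
`R` can be read off the graph. -/
theorem DSGraph.ofRel_injective (s : ℕ) :
    Function.Injective (DSGraph.ofRel : (Fin s → Fin s → Prop) → DSGraph (2 * s + 1)) := by
  have key : ∀ (R : Fin s → Fin s → Prop) a b,
      (DSGraph.ofRel R).adj ⟨a.1, by omega⟩ ⟨s + 1 + b.1, by omega⟩ ↔ R a b := by
    intro R a b
    constructor
    · rintro ⟨-, h | h | ⟨a', b', hR, ha, hb⟩⟩
      · simp only at h
        omega
      · simp only at h
        omega
      · obtain rfl : a = a' := Fin.ext ha
        obtain rfl : b = b' := Fin.ext (by simp only at hb; omega)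
        exact hR
    · exact fun h => ⟨Fin.lt_def.2 (by simp only; omega), .inr (.inr ⟨a, b, h, rfl, rfl⟩)⟩
  intro R R' h
  ext a b
  rw [← key R, ← key R', h]

theorem DSGraph.two_pow_le_card (s : ℕ) : 2 ^ (s * s) ≤ Fintype.card (DSGraph (2 * s + 1)) := by
  classical
  have := Fintype.card_le_of_injective _ (DSGraph.ofRel_injective s)
  simpa [← pow_mul] using this

/-- Quadratic exponentials eventually exceed `r! (r C) ^ r`. -/
theorem Nat.exists_factorial_mul_pow_lt_two_pow (C : ℕ) :
    ∃ s : ℕ, (2 * s + 1).factorial * ((2 * s + 1) * C) ^ (2 * s + 1) < 2 ^ (s * s) := by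
  -- The cube is there because `2 s + 1 ≤ 3 s` for `s ≥ 1`: raising this inequality to the power `s`
  -- yields the exponents `3 s` and `s * s`. Its left side has degree `6` in `s`.
  obtain ⟨s, hs, hlt⟩ : ∃ s : ℕ, 1 ≤ s ∧ ((2 * s + 1) ^ 2 * (C + 1)) ^ 3 < 2 ^ s := by
    have h := tendsto_pow_const_div_const_pow_of_one_lt 6 (r := (2 : ℝ)) (by norm_num)
    have hpos : (0 : ℝ) < 1 / (3 ^ 6 * ((C : ℝ) + 1) ^ 3) := by positivity
    obtain ⟨s, h1, h2⟩ :=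
      ((h.eventually (gt_mem_nhds hpos)).and (Filter.eventually_ge_atTop 1)).exists
    refine ⟨s, h2, ?_⟩
    rw [div_lt_div_iff₀ (by positivity) (by positivity), one_mul] at h1
    have h3 : s ^ 6 * (3 ^ 6 * (C + 1) ^ 3) < 2 ^ s := by exact_mod_cast h1
    calc ((2 * s + 1) ^ 2 * (C + 1)) ^ 3 ≤ ((3 * s) ^ 2 * (C + 1)) ^ 3 := by gcongr; omega
      _ = s ^ 6 * (3 ^ 6 * (C + 1) ^ 3) := by ring
      _ < 2 ^ s := h3
  refine ⟨s, ?_⟩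
  calc (2 * s + 1).factorial * ((2 * s + 1) * C) ^ (2 * s + 1)
      -- Replacing `C` by `C + 1` keeps the base positive, so that the exponent may be increased
      -- below.
      ≤ (2 * s + 1) ^ (2 * s + 1) * ((2 * s + 1) * (C + 1)) ^ (2 * s + 1) := by
        gcongr
        · exact Nat.factorial_le_pow _
        · omega
    _ = ((2 * s + 1) ^ 2 * (C + 1)) ^ (2 * s + 1) := by rw [← mul_pow]; ring
    _ ≤ ((2 * s + 1) ^ 2 * (C + 1)) ^ (3 * s) := Nat.pow_le_pow_right (by positivity) (by omega)
    _ = (((2 * s + 1) ^ 2 * (C + 1)) ^ 3) ^ s := by rw [pow_mul]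
    _ < (2 ^ s) ^ s := Nat.pow_lt_pow_left hlt (by omega)
    _ = 2 ^ (s * s) := by rw [pow_mul]

theorem mainTheorem5 (k : Type u) [Field k] [CharZero k] : ¬ (LieGra k).FinitelyGenerated := by
  rintro ⟨E, hE, f, hf⟩
  obtain ⟨N, hN⟩ := DirectSum.exists_forall_eq_zero_of_finite (k := k) E.obj
  -- The images of the given generators need not be graphs: up to arity `N` they are combinations of
  -- small graphs, and above `N` they vanish.
  have htop := SymmOperad.combSpan_eq_top (G := LieGra.smallGraphs k N) f hf fun n e => by
    rcases le_or_gt n N with hn | hn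
    · exact LieGra.mem_combSpan_smallGraphs k hn _
    · rw [hN n hn e, map_zero, map_zero]
      exact zero_mem _
  obtain ⟨s, hs⟩ := Nat.exists_factorial_mul_pow_lt_two_pow
    (1 + ∑ n ∈ Finset.range (N + 1), (LieGra.smallGraphs k N n).card)
  have hle := SymmOperad.finrank_le_of_combSpan_eq_top N (LieGra.smallGraphs_arity k N)
    (htop (2 * s + 1))
  have hdim : Module.finrank k ((LieGra k).obj (2 * s + 1)) =
      Fintype.card (DSGraph (2 * s + 1)) :=
    Module.finrank_finsupp_self k
  rw [hdim] at hle
  exact absurd (DSGraph.two_pow_le_card s) (not_le.2 (hle.trans_lt hs))
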